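/- For integers $n_1,n_2\ge 1$ with $n_1+n_2=6$ and reals $a,b>0$ with $a^2+b^2=1$, let $$\mathbb T(a,b)=\mathbb S^{n_1}(a)\times \mathbb S^{n_2}(b)=\{(x,y)\in\mathbb R^{n_1+1}\times\mathbb R^{n_2+1} : |x|=a,\ |y|=b\}\subset \mathbb S^7$$ be the Clifford torus of dimension $6$ with its induced metric. For a smooth map $\varphi:(M^6,g)\to(N,h)$ from a $6$-dimensional Riemannian manifold to a Riemannian (symmetric) manifold, let $\nabla$ be the connection induced on $\varphi^*TN$, let $\delta T\varphi=-\operatorname{tr}_g\nabla T\varphi$, let $\delta d=-\operatorname{tr}_g\nabla^2$ be the Laplacian on sections of $\varphi^*TN$, let $R^h$ be the curvature tensor of $h$, with the sign convention $R^h_{X,Y}Z=\nabla_X\nabla_YZ-\nabla_Y\nabla_XZ-\nabla_{[X,Y]}Z$, let $\mathcal S(V)=\operatorname{tr}_g R^h_{V,T\varphi}T\varphi$, and let $\mathrm{scal}$ be the scalar curvature of $g$. The map $\varphi$ is called harmonic if $\delta T\varphi=0$, and C-harmonic if $$\Big(\delta d-\mathcal S+\tfrac{2\,\mathrm{scal}}{15}\Big)\Big(\delta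 d-\mathcal S+\tfrac{\mathrm{scal}}{5}\Big)\delta T\varphi-2\operatorname{tr}_g R^h_{\delta T\varphi,T\varphi}\big(\nabla_{T\varphi}\,\delta T\varphi\big)=0 .$$ A $6$-dimensional submanifold of $\mathbb S^7$ is called properly C-harmonic in $\mathbb S^7$ if its inclusion is C-harmonic but not harmonic. Then no Clifford torus of dimension $6$ is properly C-harmonic in $\mathbb S^7$: for all $n_1,n_2,a,b$ as above, $\mathbb T(a,b)$ is not properly C-harmonic in $\mathbb S^7$. -/

import Mathlib

open scoped ContDiff

/-!
Riemannian geometry of (embedded, smooth) submanifolds of Euclidean spaces, with the metrics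
induced by the inner product.  A vector field on `M`, or a section of a pulled-back bundle over `M`,
is represented by a function on the ambient space of which only the values on `M` matter: the
derivative within `M` at `p ∈ M`, applied to a vector tangent to `M` at `p`, depends only on the
values on `M`.
-/
namespace EuclideanSubmanifold

noncomputable section

/-- The tangent space `T_p M` of a submanifold `M` of a Euclidean space. -/
def tangentSpace {E : Type*} [NormedAddCommGroup E] [InnerProductSpace ℝ E]
    (M : Set E) (p : E) : Submodule ℝ E :=
  Submodule.span ℝ (tangentConeAt ℝ M p)

/-- The orthogonal projection of the ambient space onto `T_p M`. -/
def tangentProj {E : Type*} [NormedAddCommGroup E] [InnerProductSpace ℝ E] [FiniteDimensional ℝ E]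
    (M : Set E) (p : E) : E →L[ℝ] E :=
  (tangentSpace M p).starProjection

/-- The tangent vector field `q ↦ (projection of v onto T_q M)`.  If `v ∈ T_p M`, its value at `p`
is `v`; it is used to extend tangent vectors to tangent vector fields in tensorial expressions. -/
def extend {E : Type*} [NormedAddCommGroup E] [InnerProductSpace ℝ E] [FiniteDimensional ℝ E]
    (M : Set E) (v : E) : E → E :=
  fun q => tangentProj M q v

/-- The trace `∑ B(eᵢ, eᵢ)` over an orthonormal basis `(eᵢ)` of `T_p M`. -/
def traceAt {E F : Type*} [NormedAddCommGroup E] [InnerProductSpace ℝ E] [FiniteDimensional ℝ E]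
    [AddCommMonoid F] (M : Set E) (p : E) (B : E → E → F) : F :=
  ∑ i, B (stdOrthonormalBasis ℝ (tangentSpace M p) i : E)
    (stdOrthonormalBasis ℝ (tangentSpace M p) i : E)

/-- The Levi-Civita connection `∇_X Y` of `M`: the tangential part of the derivative of `Y` in the
direction `X`. -/
def leviCivita {E : Type*} [NormedAddCommGroup E] [InnerProductSpace ℝ E] [FiniteDimensional ℝ E]
    (M : Set E) (X Y : E → E) : E → E :=
  fun p => tangentProj M p (fderivWithin ℝ Y M p (X p))

/-- The curvature tensor `R_{X,Y} Z = ∇_X ∇_Y Z - ∇_Y ∇_X Z - ∇_{[X,Y]} Z` of `M` at `p`. -/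
def curvature {E : Type*} [NormedAddCommGroup E] [InnerProductSpace ℝ E] [FiniteDimensional ℝ E]
    (M : Set E) (p : E) (u v w : E) : E :=
  leviCivita M (extend M u) (leviCivita M (extend M v) (extend M w)) p
    - leviCivita M (extend M v) (leviCivita M (extend M u) (extend M w)) p
    - leviCivita M (VectorField.lieBracketWithin ℝ (extend M u) (extend M v) M) (extend M w) p

/-- The Ricci tensor of `M` at `p`: the trace of `x ↦ R_{x,u} v`. -/
def ricci {E : Type*} [NormedAddCommGroup E] [InnerProductSpace ℝ E] [FiniteDimensional ℝ E]
    (M : Set E) (p : E) (u v : E) : ℝ :=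
  traceAt M p fun x y => inner ℝ (curvature M p x u v) y

/-- The scalar curvature of `M` at `p`. -/
def scal {E : Type*} [NormedAddCommGroup E] [InnerProductSpace ℝ E] [FiniteDimensional ℝ E]
    (M : Set E) (p : E) : ℝ :=
  traceAt M p (ricci M p)

section Maps

/-! Below, `φ` is a map from the submanifold `M` of `E` to the submanifold `N` of `F`. -/

variable {E F : Type*}
  [NormedAddCommGroup E] [InnerProductSpace ℝ E] [FiniteDimensional ℝ E]
  [NormedAddCommGroup F] [InnerProductSpace ℝ F] [FiniteDimensional ℝ F]

/-- The section `Tφ(X)` of `φ^*TN`, for a tangent vector field `X` on `M`. -/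
def tangentMap (M : Set E) (φ : E → F) (X : E → E) : E → F :=
  fun p => fderivWithin ℝ φ M p (X p)

/-- The connection `∇_X V` on the bundle `φ^*TN` over `M` induced by the Levi-Civita connection
of `N`. -/
def pullbackConn (M : Set E) (N : Set F) (φ : E → F) (X : E → E) (V : E → F) : E → F :=
  fun p => tangentProj N (φ p) (fderivWithin ℝ V M p (X p))

/-- The section `δTφ` of `φ^*TN`, that is, minus the trace of
`(∇_X Tφ)(Y) = ∇_X (Tφ(Y)) - Tφ(∇_X Y)`. -/
def divTangentMap (M : Set E) (N : Set F) (φ : E → F) : E → F :=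
  fun p => -traceAt M p fun u v =>
    pullbackConn M N φ (extend M u) (tangentMap M φ (extend M v)) p
      - tangentMap M φ (leviCivita M (extend M u) (extend M v)) p

/-- The Laplacian `ΔV = δdV` of a section `V` of `φ^*TN`, that is, minus the trace of
`∇²_{X,Y} V = ∇_X ∇_Y V - ∇_{∇_X Y} V`. -/
def laplacian (M : Set E) (N : Set F) (φ : E → F) (V : E → F) : E → F :=
  fun p => -traceAt M p fun u v =>
    pullbackConn M N φ (extend M u) (pullbackConn M N φ (extend M v) V) p
      - pullbackConn M N φ (leviCivita M (extend M u) (extend M v)) V p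

/-- The section `S(V) = tr R^N_{V,Tφ} Tφ` of `φ^*TN`. -/
def curvatureEnd (M : Set E) (N : Set F) (φ : E → F) (V : E → F) : E → F :=
  fun p => traceAt M p fun u v =>
    curvature N (φ p) (V p) (tangentMap M φ (extend M u) p) (tangentMap M φ (extend M v) p)

/-- The section `tr R^N_{V,Tφ} (∇_{Tφ} V)` of `φ^*TN`. -/
def curvatureDerivTerm (M : Set E) (N : Set F) (φ : E → F) (V : E → F) : E → F :=
  fun p => traceAt M p fun u v =>
    curvature N (φ p) (V p) (tangentMap M φ (extend M u) p)
      (pullbackConn M N φ (extend M v) V p)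

/-- `φ : M → N` is harmonic: `δTφ = 0`. -/
def IsHarmonicMap (M : Set E) (N : Set F) (φ : E → F) : Prop :=
  ∀ p ∈ M, divTangentMap M N φ p = 0

/-- The left-hand side
`(δd - S + 2 scal/15) (δd - S + scal/5) δTφ - 2 tr R^N_{δTφ,Tφ} (∇_{Tφ} δTφ)`
of the conformal-harmonic map equation, for a source `M` of dimension six. -/
def cHarmonicOperatorSix (M : Set E) (N : Set F) (φ : E → F) : E → F :=
  let τ : E → F := divTangentMap M N φ
  let W : E → F := fun p =>
    laplacian M N φ τ p - curvatureEnd M N φ τ p + (scal M p / 5) • τ p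
  fun p =>
    laplacian M N φ W p - curvatureEnd M N φ W p + (2 * scal M p / 15) • W p
      - (2 : ℝ) • curvatureDerivTerm M N φ τ p

/-- The smooth map `φ : M → N` is C-harmonic, for `M` of dimension six. -/
def IsCHarmonicMapSix (M : Set E) (N : Set F) (φ : E → F) : Prop :=
  ContDiffOn ℝ ∞ φ M ∧ Set.MapsTo φ M N ∧ ∀ p ∈ M, cHarmonicOperatorSix M N φ p = 0

/-- The six-dimensional submanifold `M` of `N` is properly C-harmonic in `N`: its inclusion is
C-harmonic and not harmonic. -/
def IsProperlyCHarmonicSix (M N : Set E) : Prop :=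
  IsCHarmonicMapSix M N (id : E → E) ∧ ¬ IsHarmonicMap M N (id : E → E)

end Maps

/-- The Euclidean space `ℝ^(n₁+1) × ℝ^(n₂+1) = ℝ^(n₁+n₂+2)`. -/
abbrev ProdSpace (n₁ n₂ : ℕ) : Type :=
  WithLp 2 (EuclideanSpace ℝ (Fin (n₁ + 1)) × EuclideanSpace ℝ (Fin (n₂ + 1)))

/-- The unit sphere `S^(n₁+n₂+1)` of `ℝ^(n₁+1) × ℝ^(n₂+1)`. -/
def unitSphere (n₁ n₂ : ℕ) : Set (ProdSpace n₁ n₂) :=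
  Metric.sphere 0 1

/-- The generalized Clifford torus `S^{n₁}(a) × S^{n₂}(b)`. -/
def cliffordTorus (n₁ n₂ : ℕ) (a b : ℝ) : Set (ProdSpace n₁ n₂) :=
  {p | ‖p.fst‖ = a ∧ ‖p.snd‖ = b}

end

end EuclideanSubmanifold

/-! Let `P i` be the projections onto the factors and `r i` the radii. A section q ↦ ∑ κᵢ Pᵢ q is
normal to the torus, and it is tangent to the unit sphere exactly when ∑ κᵢ rᵢ² = 0. The section δTφ
has this form, and the Laplacian and the curvature terms send such tangent sections to sections of
the same kind. Since the scalar curvature is constant, the C-harmonic equation turns into algebra on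
the coefficients κ (`cHarmonicOperatorSix_id`).

With two factors the tangency condition leaves only the multiples of the unit normal. On these, δd −
S + c is multiplication by |A|² − 6 + c, where |A|² = n₁t + n₂/t and t = b²/a²
(`shiftedLaplacianCoeff_zero_mul`). After clearing denominators the equation reads τ₀ · Q(t) = 0,
where τ₀ = n₁t − n₂ is the first coefficient of δTφ and Q is a quartic. For each splitting n₁ + n₂ =
6, Q is positive on t > 0 (`clifford_polynomial_pos`). Hence τ₀ = 0, and the inclusion is harmonic.
-/

namespace EuclideanSubmanifold

open scoped RealInnerProductSpace

/-! ### Tangent spaces, projections and traces for a general subset. -/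

section General

variable {E F : Type*} [NormedAddCommGroup E] [InnerProductSpace ℝ E]
  [NormedAddCommGroup F] [NormedSpace ℝ F]

/-- Along tangent vectors, the derivative within `M` depends only on the values on `M`. -/
theorem fderivWithin_apply_of_eqOn {M : Set E} {f g : E → F} {g' : E →L[ℝ] F} {p v : E}
    (h : Set.EqOn f g M) (hp : p ∈ M) (hg : HasFDerivAt g g' p) (hv : v ∈ tangentSpace M p) :
    fderivWithin ℝ f M p v = g' v := by
  have hf : HasFDerivWithinAt f g' M p := hg.hasFDerivWithinAt.congr h (h hp)
  have huniq : Set.EqOn (fderivWithin ℝ f M p) g' (tangentConeAt ℝ M p) :=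
    hf.differentiableWithinAt.hasFDerivWithinAt.unique_on hf
  exact LinearMap.eqOn_span (f := (fderivWithin ℝ f M p : E →ₗ[ℝ] F)) (g := (g' : E →ₗ[ℝ] F))
    huniq hv

theorem velocity_mem_tangentSpace {M : Set E} {γ : ℝ → E} {v : E} (hγ : HasDerivAt γ v 0)
    (hM : ∀ t, γ t ∈ M) : v ∈ tangentSpace M (γ 0) := by
  have h := (hγ.hasFDerivAt.hasFDerivWithinAt (s := Set.univ)).mapsTo_tangent_cone
    (show (1 : ℝ) ∈ tangentConeAt ℝ Set.univ 0 by simp)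
  refine Submodule.subset_span (tangentConeAt_mono (s := γ '' Set.univ) ?_ ?_ : v ∈ tangentConeAt ℝ M (γ 0))
  · rintro _ ⟨t, -, rfl⟩
    exact hM t
  · simpa using h

variable [FiniteDimensional ℝ E]

theorem tangentProj_mem (M : Set E) (p v : E) : tangentProj M p v ∈ tangentSpace M p :=
  Submodule.starProjection_apply_mem _ _

theorem tangentProj_of_mem {M : Set E} {p v : E} (hv : v ∈ tangentSpace M p) :
    tangentProj M p v = v :=
  Submodule.starProjection_eq_self_iff.2 hv

theorem extend_mem (M : Set E) (p v : E) : extend M v p ∈ tangentSpace M p :=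
  tangentProj_mem M p v

theorem extend_of_mem {M : Set E} {p v : E} (hv : v ∈ tangentSpace M p) : extend M v p = v :=
  tangentProj_of_mem hv

theorem traceAt_congr {G : Type*} [AddCommMonoid G] {M : Set E} {p : E} {B C : E → E → G}
    (h : ∀ e ∈ tangentSpace M p, B e e = C e e) : traceAt M p B = traceAt M p C :=
  Finset.sum_congr rfl fun _ _ => h _ (Subtype.prop _)

omit [FiniteDimensional ℝ E] in
theorem tangentMap_id {M : Set E} {X : E → E} {p : E} (hp : p ∈ M)
    (hX : X p ∈ tangentSpace M p) : tangentMap M id X p = X p := by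
  rw [tangentMap, fderivWithin_apply_of_eqOn (fun _ _ => rfl) hp (hasFDerivAt_id p) hX]
  rfl

/-- Parseval's identity in the tangent space. -/
theorem sum_inner_mul_inner_eq_inner_tangentProj (M : Set E) (p x y : E) :
    traceAt M p (fun u v => ⟪x, u⟫ * ⟪v, y⟫) = ⟪tangentProj M p x, y⟫ := by
  have h := (stdOrthonormalBasis ℝ (tangentSpace M p)).sum_inner_mul_inner
    ((tangentSpace M p).orthogonalProjectionOnto x) ((tangentSpace M p).orthogonalProjectionOnto y)
  have h1 : ∀ (z : E) (e : tangentSpace M p),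
      ⟪(tangentSpace M p).orthogonalProjectionOnto z, e⟫ = ⟪z, (e : E)⟫ := fun z e => by
    rw [Submodule.coe_inner, ← Submodule.starProjection_apply,
      Submodule.inner_starProjection_left_eq_right,
      Submodule.starProjection_eq_self_iff.2 e.2]
  have h2 : ∀ (z : E) (e : tangentSpace M p),
      ⟪e, (tangentSpace M p).orthogonalProjectionOnto z⟫ = ⟪(e : E), z⟫ := fun z e => by
    rw [real_inner_comm, h1, real_inner_comm]
  simp only [h1, h2] at h
  rw [traceAt, h, ← Submodule.starProjection_apply, real_inner_comm,
    Submodule.inner_starProjection_left_eq_right, real_inner_comm]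
  rfl

end General

/-! ### Tangent spaces of products of spheres. -/

section SphereProduct

variable {E ι : Type*} [NormedAddCommGroup E] [InnerProductSpace ℝ E] [Fintype ι]

/-- The `P i` are the orthogonal projections onto the summands of an orthogonal decomposition. -/
structure IsOrthogonalResolution (P : ι → E →L[ℝ] E) : Prop where
  inner_comm : ∀ i x y, ⟪P i x, y⟫ = ⟪x, P i y⟫
  apply_self : ∀ i x, P i (P i x) = P i x
  apply_of_ne : ∀ i j x, i ≠ j → P i (P j x) = 0
  sum_apply : ∀ x, ∑ i, P i x = x

/-- The product of the spheres of radii `r i` in the ranges of the `P i`. -/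
def sphereProduct (P : ι → E →L[ℝ] E) (r : ι → ℝ) : Set E :=
  {q | ∀ i, ‖P i q‖ = r i}

variable {P : ι → E →L[ℝ] E} {r : ι → ℝ}

namespace IsOrthogonalResolution

variable (hP : IsOrthogonalResolution P)
include hP

theorem inner_apply_apply (i : ι) (x y : E) : ⟪P i x, P i y⟫ = ⟪x, P i y⟫ := by
  rw [hP.inner_comm, hP.apply_self]

theorem inner_apply_of_mem {q : E} (hq : q ∈ sphereProduct P r) (i : ι) :
    ⟪q, P i q⟫ = r i ^ 2 := by
  rw [← hP.inner_apply_apply, real_inner_self_eq_norm_sq, hq i]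

theorem apply_sum_smul [DecidableEq ι] (κ : ι → ℝ) (x : ι → E) (j : ι) :
    P j (∑ i, κ i • P i (x i)) = κ j • P j (x j) := by
  rw [map_sum, Finset.sum_eq_single j]
  · rw [map_smul, hP.apply_self]
  · intro i _ hij
    rw [map_smul, hP.apply_of_ne _ _ _ hij.symm, smul_zero]
  · simp

theorem norm_sq (x : E) : ‖x‖ ^ 2 = ∑ i, ‖P i x‖ ^ 2 := by
  have : ∀ i, ‖P i x‖ ^ 2 = ⟪x, P i x⟫ := fun i => by
    rw [← real_inner_self_eq_norm_sq, hP.inner_apply_apply]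
  simp only [this]
  rw [← inner_sum, hP.sum_apply, real_inner_self_eq_norm_sq]

/-- Differentiate the constant function ‖Pᵢ q‖² = rᵢ² along `v`. -/
theorem inner_apply_eq_zero_of_mem_tangentSpace {p v : E} (hp : p ∈ sphereProduct P r)
    (hv : v ∈ tangentSpace (sphereProduct P r) p) (i : ι) : ⟪v, P i p⟫ = 0 := by
  have hd : HasFDerivAt (fun q : E => ⟪P i q, P i q⟫)
      ((fderivInnerCLM ℝ (P i p, P i p)).comp ((P i).prod (P i))) p :=
    (P i).hasFDerivAt.inner ℝ (P i).hasFDerivAt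
  have h1 := fderivWithin_apply_of_eqOn (f := fun _ => r i ^ 2) (M := sphereProduct P r)
    (fun q hq => by simp only [real_inner_self_eq_norm_sq, hq i]) hp hd hv
  rw [fderivWithin_fun_const] at h1
  simp only [Pi.zero_apply, zero_apply, ContinuousLinearMap.comp_apply,
    ContinuousLinearMap.prod_apply, fderivInnerCLM_apply] at h1
  rw [real_inner_comm, ← two_mul, hP.inner_apply_apply] at h1
  linarith

theorem mem_tangentSpace_of_inner_apply_eq_zero [DecidableEq ι] (hr : ∀ i, 0 < r i) {p v : E}
    (hp : p ∈ sphereProduct P r) (hv : ∀ i, ⟪v, P i p⟫ = 0) :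
    v ∈ tangentSpace (sphereProduct P r) p := by
  -- As `P i v` is orthogonal to `P i p`, the component `P i (p + t • v)` has squared norm rᵢ² +
  -- t²‖Pᵢ v‖². The factor `g i` rescales it to length rᵢ and is even in t, so the velocity at 0
  -- remains `v`.
  set g : ι → ℝ → ℝ := fun i t => r i / Real.sqrt (r i ^ 2 + t ^ 2 * ‖P i v‖ ^ 2) with hg
  have hg0 : ∀ i, g i 0 = 1 := fun i => by
    simp [hg, Real.sqrt_sq (hr i).le, (hr i).ne']
  have hgd : ∀ i, HasDerivAt (g i) 0 0 := fun i => by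
    have h1 : HasDerivAt (fun t : ℝ => r i ^ 2 + t ^ 2 * ‖P i v‖ ^ 2) 0 0 := by
      simpa using ((hasDerivAt_pow 2 (0 : ℝ)).mul_const (‖P i v‖ ^ 2)).const_add (r i ^ 2)
    have h2 := h1.sqrt (by simp [(hr i).ne'])
    have h3 := (hasDerivAt_const (0 : ℝ) (r i)).fun_div h2
      (by simp [Real.sqrt_sq (hr i).le, (hr i).ne'])
    simpa using h3
  set γ : ℝ → E := fun t => ∑ i, g i t • P i (p + t • v) with hγ
  have hγ0 : γ 0 = p := by simp [hγ, hg0, hP.sum_apply]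
  have hγd : HasDerivAt γ v 0 := by
    have h1 : ∀ i, HasDerivAt (fun t => g i t • P i (p + t • v)) (P i v) 0 := fun i => by
      have h2 : HasDerivAt (fun t : ℝ => p + t • v) v 0 := by
        simpa using ((hasDerivAt_id (0 : ℝ)).smul_const v).const_add p
      have h3 := (hgd i).fun_smul ((P i).hasFDerivAt.comp_hasDerivAt (0 : ℝ) h2)
      simpa [hg0] using h3
    have h4 := HasDerivAt.fun_sum fun i (_ : i ∈ Finset.univ) => h1 i
    rwa [hP.sum_apply] at h4
  have hmem : ∀ t, γ t ∈ sphereProduct P r := fun t j => by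
    have hpos : 0 < r j ^ 2 + t ^ 2 * ‖P j v‖ ^ 2 := by
      have := hr j
      positivity
    have hn : ‖P j (p + t • v)‖ = Real.sqrt (r j ^ 2 + t ^ 2 * ‖P j v‖ ^ 2) := by
      rw [eq_comm, Real.sqrt_eq_iff_mul_self_eq hpos.le (norm_nonneg _), map_add, map_smul,
        ← sq, norm_add_sq_real, hp j, inner_smul_right, real_inner_comm, hP.inner_apply_apply,
        hv j, norm_smul, mul_pow, Real.norm_eq_abs, sq_abs]
      ring
    rw [hγ, hP.apply_sum_smul (fun i => g i t), norm_smul, hn, hg, Real.norm_eq_abs,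
      abs_of_nonneg (div_nonneg (hr j).le (Real.sqrt_nonneg _)),
      div_mul_cancel₀ _ (Real.sqrt_pos.2 hpos).ne']
  simpa only [hγ0] using velocity_mem_tangentSpace hγd hmem

theorem mem_tangentSpace_iff [DecidableEq ι] (hr : ∀ i, 0 < r i) {p v : E}
    (hp : p ∈ sphereProduct P r) :
    v ∈ tangentSpace (sphereProduct P r) p ↔ ∀ i, ⟪v, P i p⟫ = 0 :=
  ⟨hP.inner_apply_eq_zero_of_mem_tangentSpace hp, hP.mem_tangentSpace_of_inner_apply_eq_zero hr hp⟩

theorem apply_mem_tangentSpace [DecidableEq ι] (hr : ∀ i, 0 < r i) {p v : E}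
    (hp : p ∈ sphereProduct P r) (hv : v ∈ tangentSpace (sphereProduct P r) p) (i : ι) :
    P i v ∈ tangentSpace (sphereProduct P r) p := by
  rw [hP.mem_tangentSpace_iff hr hp] at hv ⊢
  intro j
  rw [hP.inner_comm]
  obtain rfl | hij := eq_or_ne i j
  · rw [hP.apply_self, hv]
  · rw [hP.apply_of_ne _ _ _ hij, inner_zero_right]

variable [FiniteDimensional ℝ E] [DecidableEq ι]

/-- The vectors `P i p` are mutually orthogonal of length `r i` and span the normal space. -/
theorem tangentProj_apply (hr : ∀ i, 0 < r i) {p : E} (hp : p ∈ sphereProduct P r) (v : E) :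
    tangentProj (sphereProduct P r) p v = v - ∑ i, ((r i ^ 2)⁻¹ * ⟪v, P i p⟫) • P i p := by
  refine Submodule.eq_starProjection_of_mem_of_inner_eq_zero ?_ fun w hw => ?_
  · rw [hP.mem_tangentSpace_iff hr hp]
    intro j
    rw [inner_sub_left, ← hP.inner_comm j (∑ i, _), hP.apply_sum_smul _ (fun _ => p),
      inner_smul_left, hP.inner_comm, hP.inner_apply_of_mem hp]
    have := (hr j).ne'
    simp only [conj_trivial]
    field_simp
    ring
  · rw [sub_sub_cancel, sum_inner]
    refine Finset.sum_eq_zero fun i _ => ?_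
    rw [inner_smul_left, real_inner_comm w,
      hP.inner_apply_eq_zero_of_mem_tangentSpace hp hw, mul_zero]

theorem tangentProj_apply_self (hr : ∀ i, 0 < r i) {p : E} (hp : p ∈ sphereProduct P r) (i : ι) :
    tangentProj (sphereProduct P r) p (P i p) = 0 := by
  have h : ∀ j, ⟪P i p, P j p⟫ = if j = i then r i ^ 2 else 0 := fun j => by
    split_ifs with hij
    · rw [hij, hP.inner_apply_apply, hP.inner_apply_of_mem hp]
    · rw [hP.inner_comm, hP.apply_of_ne _ _ _ (Ne.symm hij), inner_zero_right]
  rw [hP.tangentProj_apply hr hp]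
  simp [h, (hr i).ne']

end IsOrthogonalResolution

end SphereProduct

/-! ### Levi-Civita connection and curvature of products of spheres. -/

section Connection

variable {E ι : Type*} [NormedAddCommGroup E] [InnerProductSpace ℝ E] [Fintype ι]

theorem hasFDerivAt_sum_inner_smul (P : ι → E →L[ℝ] E) (c : ι → ℝ) (w : E) {f : E → E}
    {f' : E →L[ℝ] E} {p : E} (hf : HasFDerivAt f f' p) :
    HasFDerivAt (fun q => ∑ i, (c i * ⟪w, P i q⟫) • P i (f q))
      (∑ i, ((c i * ⟪w, P i p⟫) • (P i).comp f' +
        (c i • (innerSL ℝ w).comp (P i)).smulRight (P i (f p)))) p := by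
  refine HasFDerivAt.fun_sum fun i _ => ?_
  have h1 : HasFDerivAt (fun q => c i * ⟪w, P i q⟫) (c i • (innerSL ℝ w).comp (P i)) p :=
    (c i • (innerSL ℝ w).comp (P i)).hasFDerivAt
  exact h1.fun_smul ((P i).hasFDerivAt.comp p hf)

variable [FiniteDimensional ℝ E] [DecidableEq ι] {P : ι → E →L[ℝ] E} {r : ι → ℝ}

namespace IsOrthogonalResolution

variable (hP : IsOrthogonalResolution P) (hr : ∀ i, 0 < r i)
include hP hr

/-- The projection formula holds only on the product, but it is quadratic in q, hence gives a
function differentiable on the ambient space to work with. -/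
theorem exists_hasFDerivAt_eqOn_extend (v p : E) :
    ∃ (g : E → E) (g' : E →L[ℝ] E), Set.EqOn (extend (sphereProduct P r) v) g (sphereProduct P r) ∧
      HasFDerivAt g g' p ∧ ∀ x, g' x = -∑ i, (((r i ^ 2)⁻¹ * ⟪v, P i p⟫) • P i x +
        ((r i ^ 2)⁻¹ * ⟪v, P i x⟫) • P i p) := by
  refine ⟨_, _, fun q hq => hP.tangentProj_apply hr hq v,
    (hasFDerivAt_sum_inner_smul P (fun i => (r i ^ 2)⁻¹) v (hasFDerivAt_id p)).const_sub v,
    fun x => ?_⟩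
  simp

theorem fderivWithin_comp_extend (L : E →L[ℝ] E) {f : E → E} (v : E)
    (hf : Set.EqOn f (fun q => L (extend (sphereProduct P r) v q)) (sphereProduct P r))
    {p x : E} (hp : p ∈ sphereProduct P r) (hx : x ∈ tangentSpace (sphereProduct P r) p) :
    fderivWithin ℝ f (sphereProduct P r) p x =
      -L (∑ i, (((r i ^ 2)⁻¹ * ⟪v, P i p⟫) • P i x + ((r i ^ 2)⁻¹ * ⟪v, P i x⟫) • P i p)) := by
  obtain ⟨g, g', hg, hg', h⟩ := hP.exists_hasFDerivAt_eqOn_extend hr v p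
  rw [fderivWithin_apply_of_eqOn (hf.trans fun q hq => congrArg L (hg hq)) hp
    (L.hasFDerivAt.comp p hg') hx]
  simp only [ContinuousLinearMap.comp_apply, h, map_neg]

theorem fderivWithin_extend (v : E) {p x : E} (hp : p ∈ sphereProduct P r)
    (hx : x ∈ tangentSpace (sphereProduct P r) p) :
    fderivWithin ℝ (extend (sphereProduct P r) v) (sphereProduct P r) p x =
      -∑ i, (((r i ^ 2)⁻¹ * ⟪v, P i p⟫) • P i x + ((r i ^ 2)⁻¹ * ⟪v, P i x⟫) • P i p) :=
  hP.fderivWithin_comp_extend hr (ContinuousLinearMap.id ℝ E) v (fun _ _ => rfl) hp hx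

/-- The terms along `P i p` are normal and drop out. The vector `v` is arbitrary, because a second
derivative needs the formula at points where `v` is no longer tangent. -/
theorem leviCivita_extend {X : E → E} (v : E) {p : E} (hp : p ∈ sphereProduct P r)
    (hX : X p ∈ tangentSpace (sphereProduct P r) p) :
    leviCivita (sphereProduct P r) X (extend (sphereProduct P r) v) p =
      -∑ i, ((r i ^ 2)⁻¹ * ⟪v, P i p⟫) • P i (X p) := by
  rw [leviCivita, hP.fderivWithin_extend hr v hp hX, map_neg, map_sum]
  congr 1
  refine Finset.sum_congr rfl fun i _ => ?_
  rw [map_add, map_smul, map_smul, hP.tangentProj_apply_self hr hp, smul_zero, add_zero,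
    tangentProj_of_mem (hP.apply_mem_tangentSpace hr hp hX i)]

/-- This removes the correction terms ∇_X Y from the traces defining δTφ and the Laplacian. -/
theorem leviCivita_extend_of_mem {X : E → E} {v p : E} (hp : p ∈ sphereProduct P r)
    (hX : X p ∈ tangentSpace (sphereProduct P r) p)
    (hv : v ∈ tangentSpace (sphereProduct P r) p) :
    leviCivita (sphereProduct P r) X (extend (sphereProduct P r) v) p = 0 := by
  simp [hP.leviCivita_extend hr v hp hX, hP.inner_apply_eq_zero_of_mem_tangentSpace hp hv]

/-- Since ⟪w, Pᵢ p⟫ = 0, only the derivative of the coefficient ⟪w, Pᵢ q⟫ survives at `p`. -/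
theorem leviCivita_leviCivita_extend {u v w p : E} (hp : p ∈ sphereProduct P r)
    (hu : u ∈ tangentSpace (sphereProduct P r) p) (hv : v ∈ tangentSpace (sphereProduct P r) p)
    (hw : w ∈ tangentSpace (sphereProduct P r) p) :
    leviCivita (sphereProduct P r) (extend (sphereProduct P r) u)
        (leviCivita (sphereProduct P r) (extend (sphereProduct P r) v)
          (extend (sphereProduct P r) w)) p =
      -∑ i, ((r i ^ 2)⁻¹ * ⟪w, P i u⟫) • P i v := by
  obtain ⟨g, g', hg, hg', -⟩ := hP.exists_hasFDerivAt_eqOn_extend hr v p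
  have heq : Set.EqOn (leviCivita (sphereProduct P r) (extend (sphereProduct P r) v)
      (extend (sphereProduct P r) w)) (fun q => -∑ i, ((r i ^ 2)⁻¹ * ⟪w, P i q⟫) • P i (g q))
      (sphereProduct P r) := fun q hq => by
    simp only [hP.leviCivita_extend hr w hq (extend_mem _ _ _), hg hq]
  rw [leviCivita, extend_of_mem hu, fderivWithin_apply_of_eqOn heq hp
    (hasFDerivAt_sum_inner_smul P (fun i => (r i ^ 2)⁻¹) w hg').fun_neg hu,
    ← hg hp, extend_of_mem hv]
  have h : ∀ i, tangentProj (sphereProduct P r) p (P i v) = P i v := fun i =>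
    tangentProj_of_mem (hP.apply_mem_tangentSpace hr hp hv i)
  simp [hP.inner_apply_eq_zero_of_mem_tangentSpace hp hw, h]

/-- The Gauss equation for a product of spheres. -/
theorem curvature_apply {u v w p : E} (hp : p ∈ sphereProduct P r)
    (hu : u ∈ tangentSpace (sphereProduct P r) p) (hv : v ∈ tangentSpace (sphereProduct P r) p)
    (hw : w ∈ tangentSpace (sphereProduct P r) p) :
    curvature (sphereProduct P r) p u v w =
      ∑ i, (r i ^ 2)⁻¹ • (⟪w, P i v⟫ • P i u - ⟪w, P i u⟫ • P i v) := by
  -- The derivative of one extension along the other is symmetric in `u` and `v` at `p`, so the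
  -- bracket vanishes there.
  have hb : VectorField.lieBracketWithin ℝ (extend (sphereProduct P r) u)
      (extend (sphereProduct P r) v) (sphereProduct P r) p = 0 := by
    rw [VectorField.lieBracketWithin, extend_of_mem hu, extend_of_mem hv,
      hP.fderivWithin_extend hr v hp hu, hP.fderivWithin_extend hr u hp hv]
    simp only [hP.inner_apply_eq_zero_of_mem_tangentSpace hp hu,
      hP.inner_apply_eq_zero_of_mem_tangentSpace hp hv, mul_zero, zero_smul, zero_add]
    rw [sub_eq_zero]
    congr 1
    refine Finset.sum_congr rfl fun i _ => ?_
    rw [← hP.inner_comm, real_inner_comm]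
  rw [curvature, hP.leviCivita_leviCivita_extend hr hp hu hv hw,
    hP.leviCivita_leviCivita_extend hr hp hv hu hw,
    hP.leviCivita_extend_of_mem hr hp (hb ▸ zero_mem _) hw, sub_zero, neg_sub_neg,
    ← Finset.sum_sub_distrib]
  refine Finset.sum_congr rfl fun i _ => ?_
  rw [smul_sub, smul_smul, smul_smul]

/-- The trace of `P i` over the tangent space. -/
theorem traceAt_inner_apply {p : E} (hp : p ∈ sphereProduct P r) (i : ι) :
    traceAt (sphereProduct P r) p (fun u v => ⟪u, P i v⟫) =
      LinearMap.trace ℝ E (P i) - 1 := by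
  set b := stdOrthonormalBasis ℝ E
  -- Expanding in an orthonormal basis of `E` turns the sum into the trace of the tangential
  -- projection composed with `P i`. The projection removes from the range of `P i` only the line
  -- through `P i p`, whence the −1.
  have h1 : ∀ e : E, ⟪e, P i e⟫ = ∑ j, ⟪P i (b j), e⟫ * ⟪e, b j⟫ := fun e => by
    rw [← b.sum_inner_mul_inner e (P i e)]
    refine Finset.sum_congr rfl fun j _ => ?_
    rw [hP.inner_comm, mul_comm]
  have h2 : traceAt (sphereProduct P r) p (fun u v => ⟪u, P i v⟫) =
      ∑ j, traceAt (sphereProduct P r) p (fun u v => ⟪P i (b j), u⟫ * ⟪v, b j⟫) := by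
    simp only [traceAt, h1]
    exact Finset.sum_comm
  have h3 : ∀ j, ⟪tangentProj (sphereProduct P r) p (P i (b j)), b j⟫ =
      ⟪b j, P i (b j)⟫ - (r i ^ 2)⁻¹ * (⟪P i p, b j⟫ * ⟪b j, P i p⟫) := fun j => by
    have h4 : ∀ k, ⟪P i (b j), P k p⟫ = if k = i then ⟪b j, P i p⟫ else 0 := fun k => by
      split_ifs with hk
      · rw [hk, hP.inner_apply_apply]
      · rw [hP.inner_comm, hP.apply_of_ne _ _ _ (Ne.symm hk), inner_zero_right]
    rw [hP.tangentProj_apply hr hp, inner_sub_left, sum_inner, Finset.sum_eq_single i]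
    · rw [h4, if_pos rfl, inner_smul_left, conj_trivial, real_inner_comm (P i (b j))]
      ring
    · intro k _ hk
      rw [h4, if_neg hk, mul_zero, zero_smul, inner_zero_left]
    · simp
  rw [h2]
  simp only [sum_inner_mul_inner_eq_inner_tangentProj, h3]
  rw [Finset.sum_sub_distrib, ← Finset.mul_sum, b.sum_inner_mul_inner, hP.inner_apply_apply,
    hP.inner_apply_of_mem hp, inv_mul_cancel₀ (pow_ne_zero 2 (hr i).ne'),
    LinearMap.trace_eq_sum_inner _ b]
  rfl

/-- The trace of `P i` is one more than the dimension nᵢ of the i-th sphere, so the coefficient is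
the usual (nᵢ − 1)/rᵢ². -/
theorem ricci_apply {p u v : E} (hp : p ∈ sphereProduct P r)
    (hu : u ∈ tangentSpace (sphereProduct P r) p) (hv : v ∈ tangentSpace (sphereProduct P r) p) :
    ricci (sphereProduct P r) p u v =
      ∑ i, (LinearMap.trace ℝ E (P i) - 2) / r i ^ 2 * ⟪u, P i v⟫ := by
  have h1 : ricci (sphereProduct P r) p u v = traceAt (sphereProduct P r) p fun x y =>
      ∑ i, (r i ^ 2)⁻¹ * (⟪u, P i v⟫ * ⟪x, P i y⟫ - ⟪P i v, x⟫ * ⟪y, P i u⟫) := by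
    refine traceAt_congr fun e he => ?_
    rw [hP.curvature_apply hr hp he hu hv, sum_inner]
    refine Finset.sum_congr rfl fun i _ => ?_
    rw [inner_smul_left, inner_sub_left, inner_smul_left, inner_smul_left, conj_trivial,
      conj_trivial, conj_trivial, hP.inner_comm i e, hP.inner_comm i v, ← hP.inner_comm i v u,
      ← hP.inner_comm i v e, hP.inner_comm i u e, ← hP.inner_comm i u e, real_inner_comm e (P i u),
      real_inner_comm (P i v) u]
  rw [h1]
  simp only [traceAt]
  rw [Finset.sum_comm]
  refine Finset.sum_congr rfl fun i _ => ?_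
  rw [← Finset.mul_sum, Finset.sum_sub_distrib, ← Finset.mul_sum]
  have h2 := hP.traceAt_inner_apply hr hp i
  have h3 := sum_inner_mul_inner_eq_inner_tangentProj (sphereProduct P r) p (P i v) (P i u)
  rw [tangentProj_of_mem (hP.apply_mem_tangentSpace hr hp hv i), hP.inner_apply_apply,
    ← hP.inner_comm, real_inner_comm] at h3
  simp only [traceAt] at h2 h3
  rw [h2, h3]
  ring

theorem scal_eq {p : E} (hp : p ∈ sphereProduct P r) :
    scal (sphereProduct P r) p =
      ∑ i, (LinearMap.trace ℝ E (P i) - 1) * (LinearMap.trace ℝ E (P i) - 2) / r i ^ 2 := by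
  rw [scal, traceAt_congr (C := fun u v => ∑ i, (LinearMap.trace ℝ E (P i) - 2) / r i ^ 2 *
    ⟪u, P i v⟫) fun e he => hP.ricci_apply hr hp he he, traceAt, Finset.sum_comm]
  refine Finset.sum_congr rfl fun i _ => ?_
  have h2 := hP.traceAt_inner_apply hr hp i
  rw [traceAt] at h2
  rw [← Finset.mul_sum, h2]
  ring

end IsOrthogonalResolution

end Connection

/-! ### The target sphere, as a product with a single factor. -/

section UnitSphere

variable {E : Type*} [NormedAddCommGroup E] [InnerProductSpace ℝ E]

theorem isOrthogonalResolution_id :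
    IsOrthogonalResolution (fun _ : Unit => ContinuousLinearMap.id ℝ E) where
  inner_comm _ _ _ := rfl
  apply_self _ _ := rfl
  apply_of_ne i j _ h := (h (Subsingleton.elim i j)).elim
  sum_apply x := by simp

theorem sphere_eq_sphereProduct : Metric.sphere (0 : E) 1 =
    sphereProduct (fun _ : Unit => ContinuousLinearMap.id ℝ E) (fun _ => 1) := by
  ext q
  simp [sphereProduct]

theorem mem_tangentSpace_sphere_iff {p v : E} (hp : p ∈ Metric.sphere (0 : E) 1) :
    v ∈ tangentSpace (Metric.sphere (0 : E) 1) p ↔ ⟪v, p⟫ = 0 := by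
  rw [sphere_eq_sphereProduct] at hp ⊢
  rw [isOrthogonalResolution_id.mem_tangentSpace_iff (fun _ => one_pos) hp]
  simp

variable [FiniteDimensional ℝ E]

theorem tangentProj_sphere_apply {p : E} (hp : p ∈ Metric.sphere (0 : E) 1) (v : E) :
    tangentProj (Metric.sphere (0 : E) 1) p v = v - ⟪v, p⟫ • p := by
  rw [sphere_eq_sphereProduct] at hp ⊢
  rw [isOrthogonalResolution_id.tangentProj_apply (fun _ => one_pos) hp]
  simp

theorem curvature_sphere_apply {p u v w : E} (hp : p ∈ Metric.sphere (0 : E) 1)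
    (hu : ⟪u, p⟫ = 0) (hv : ⟪v, p⟫ = 0) (hw : ⟪w, p⟫ = 0) :
    curvature (Metric.sphere (0 : E) 1) p u v w = ⟪w, v⟫ • u - ⟪w, u⟫ • v := by
  rw [← mem_tangentSpace_sphere_iff hp] at hu hv hw
  rw [sphere_eq_sphereProduct] at hp hu hv hw ⊢
  rw [isOrthogonalResolution_id.curvature_apply (fun _ => one_pos) hp hu hv hw]
  simp

end UnitSphere

/-! ### Diagonal sections along the inclusion into the unit sphere. -/

section Inclusion

variable {E ι : Type*} [NormedAddCommGroup E] [InnerProductSpace ℝ E] [Fintype ι]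

/-- The operator acting on the range of `P i` as the scalar `κ i`. -/
noncomputable def diagonalOperator (P : ι → E →L[ℝ] E) (κ : ι → ℝ) : E →L[ℝ] E :=
  ∑ i, κ i • P i

/-- The coefficients of the Laplacian of the section `q ↦ ∑ κᵢ Pᵢ q`, for a product of spheres of
dimensions `n i` and radii `r i`. -/
noncomputable def laplacianCoeff (n r κ : ι → ℝ) (i : ι) : ℝ :=
  κ i * (n i / r i ^ 2) - ∑ j, κ j * n j

variable {P : ι → E →L[ℝ] E} {r n : ι → ℝ}

theorem diagonalOperator_apply (κ : ι → ℝ) (x : E) :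
    diagonalOperator P κ x = ∑ i, κ i • P i x := by
  simp [diagonalOperator]

/-- The vanishing sum expresses tangency to the unit sphere, needed in order to apply the curvature
formula again. -/
theorem sum_laplacianCoeff_mul_sq (hr : ∀ i, 0 < r i) (hsum : ∑ i, r i ^ 2 = 1) (κ : ι → ℝ) :
    ∑ i, laplacianCoeff n r κ i * r i ^ 2 = 0 := by
  have h : ∀ i, laplacianCoeff n r κ i * r i ^ 2 = κ i * n i - (∑ j, κ j * n j) * r i ^ 2 :=
    fun i => by
      have := (hr i).ne'
      rw [laplacianCoeff]
      field_simp
  simp only [h]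
  rw [Finset.sum_sub_distrib, ← Finset.mul_sum, hsum, mul_one, sub_self]

namespace IsOrthogonalResolution

variable (hP : IsOrthogonalResolution P)
include hP

theorem sphereProduct_subset_sphere (hsum : ∑ i, r i ^ 2 = 1) :
    sphereProduct P r ⊆ Metric.sphere (0 : E) 1 := fun q hq => by
  have h := hP.norm_sq q
  simp only [hq _, hsum] at h
  rw [mem_sphere_zero_iff_norm]
  nlinarith [norm_nonneg q]

theorem inner_diagonalOperator_of_mem (κ : ι → ℝ) {p v : E} (hp : p ∈ sphereProduct P r)
    (hv : v ∈ tangentSpace (sphereProduct P r) p) :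
    ⟪v, diagonalOperator P κ p⟫ = 0 := by
  rw [diagonalOperator_apply, inner_sum]
  refine Finset.sum_eq_zero fun i _ => ?_
  rw [inner_smul_right, hP.inner_apply_eq_zero_of_mem_tangentSpace hp hv, mul_zero]

theorem inner_self_of_mem {p v : E} (hp : p ∈ sphereProduct P r)
    (hv : v ∈ tangentSpace (sphereProduct P r) p) : ⟪v, p⟫ = 0 := by
  have h := hP.inner_diagonalOperator_of_mem (fun _ => 1) hp hv
  simpa only [diagonalOperator_apply, one_smul, hP.sum_apply] using h

theorem inner_diagonalOperator_self (κ : ι → ℝ) {p : E} (hp : p ∈ sphereProduct P r) :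
    ⟪diagonalOperator P κ p, p⟫ = ∑ i, κ i * r i ^ 2 := by
  rw [diagonalOperator_apply, sum_inner]
  refine Finset.sum_congr rfl fun i _ => ?_
  rw [inner_smul_left, conj_trivial, hP.inner_comm, hP.inner_apply_of_mem hp]

variable [DecidableEq ι]

/-- As `P i p` has length `r i` > 0, a single point determines the coefficients. -/
theorem eq_zero_of_diagonalOperator_apply_eq_zero (hr : ∀ i, 0 < r i) {κ : ι → ℝ} {p : E}
    (hp : p ∈ sphereProduct P r) (h : diagonalOperator P κ p = 0) (i : ι) : κ i = 0 := by
  have h1 := congrArg (P i) h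
  rw [diagonalOperator_apply, hP.apply_sum_smul κ (fun _ => p), map_zero, smul_eq_zero] at h1
  refine h1.resolve_right fun h2 => (hr i).ne' ?_
  rw [← hp i, h2, norm_zero]

theorem diagonalOperator_sum_smul (κ μ : ι → ℝ) (p : E) :
    diagonalOperator P κ (∑ i, μ i • P i p) = diagonalOperator P (fun i => κ i * μ i) p := by
  simp only [diagonalOperator_apply, hP.apply_sum_smul μ (fun _ => p), smul_smul]

theorem diagonalOperator_mem (hr : ∀ i, 0 < r i) (κ : ι → ℝ) {p v : E}
    (hp : p ∈ sphereProduct P r) (hv : v ∈ tangentSpace (sphereProduct P r) p) :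
    diagonalOperator P κ v ∈ tangentSpace (sphereProduct P r) p := by
  rw [diagonalOperator_apply]
  exact sum_mem fun i _ => Submodule.smul_mem _ _ (hP.apply_mem_tangentSpace hr hp hv i)

variable [FiniteDimensional ℝ E]

/-- The derivative of V is already tangent to the product, hence to the sphere, and projecting
changes nothing. -/
theorem pullbackConn_diagonalOperator (hr : ∀ i, 0 < r i) (hsum : ∑ i, r i ^ 2 = 1) {X V : E → E}
    {κ : ι → ℝ} {p : E} (hV : Set.EqOn V (diagonalOperator P κ) (sphereProduct P r))
    (hp : p ∈ sphereProduct P r) (hX : X p ∈ tangentSpace (sphereProduct P r) p) :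
    pullbackConn (sphereProduct P r) (Metric.sphere 0 1) id X V p =
      diagonalOperator P κ (X p) := by
  rw [pullbackConn, fderivWithin_apply_of_eqOn hV hp (diagonalOperator P κ).hasFDerivAt hX, id]
  refine tangentProj_of_mem ?_
  rw [mem_tangentSpace_sphere_iff (hP.sphereProduct_subset_sphere hsum hp)]
  exact hP.inner_self_of_mem hp (hP.diagonalOperator_mem hr κ hp hX)

theorem traceAt_inner_diagonalOperator (hr : ∀ i, 0 < r i)
    (hn : ∀ i, LinearMap.trace ℝ E (P i) = n i + 1) (κ : ι → ℝ) {p : E}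
    (hp : p ∈ sphereProduct P r) :
    traceAt (sphereProduct P r) p (fun u v => ⟪u, diagonalOperator P κ v⟫) = ∑ i, κ i * n i := by
  simp only [traceAt, diagonalOperator_apply, inner_sum, inner_smul_right]
  rw [Finset.sum_comm]
  refine Finset.sum_congr rfl fun i _ => ?_
  have h := hP.traceAt_inner_apply hr hp i
  rw [hn, add_sub_cancel_right, traceAt] at h
  rw [← Finset.mul_sum, h]

/-- The common computation behind `δTφ` (for `κ = 1`) and behind the Laplacian. -/
theorem neg_traceAt_fderivWithin_comp_extend (hr : ∀ i, 0 < r i) (hsum : ∑ i, r i ^ 2 = 1)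
    (hn : ∀ i, LinearMap.trace ℝ E (P i) = n i + 1) (κ : ι → ℝ) {f : E → E → E}
    (hf : ∀ v, Set.EqOn (f v) (fun q => diagonalOperator P κ (extend (sphereProduct P r) v q))
      (sphereProduct P r)) {p : E} (hp : p ∈ sphereProduct P r) :
    -traceAt (sphereProduct P r) p (fun u v =>
      pullbackConn (sphereProduct P r) (Metric.sphere 0 1) id (extend (sphereProduct P r) u) (f v)
        p) = diagonalOperator P (laplacianCoeff n r κ) p := by
  have hpN := hP.sphereProduct_subset_sphere hsum hp
  have h1 : ∀ e ∈ tangentSpace (sphereProduct P r) p,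
      pullbackConn (sphereProduct P r) (Metric.sphere 0 1) id (extend (sphereProduct P r) e) (f e)
        p = -∑ i, ⟪e, P i e⟫ • tangentProj (Metric.sphere 0 1) p (diagonalOperator P κ
          ((r i ^ 2)⁻¹ • P i p)) := fun e he => by
    rw [pullbackConn, extend_of_mem he, hP.fderivWithin_comp_extend hr _ e (hf e) hp he]
    simp only [hP.inner_apply_eq_zero_of_mem_tangentSpace hp he, mul_zero, zero_smul, zero_add,
      map_neg, map_sum, map_smul, smul_smul, id, mul_comm]
  have h2 : ∀ i, traceAt (sphereProduct P r) p (fun u v => ⟪u, P i v⟫) = n i := fun i => by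
    rw [hP.traceAt_inner_apply hr hp, hn, add_sub_cancel_right]
  rw [traceAt_congr (C := fun u v => -∑ i, ⟪u, P i v⟫ • tangentProj (Metric.sphere 0 1) p
    (diagonalOperator P κ ((r i ^ 2)⁻¹ • P i p))) h1, traceAt, Finset.sum_neg_distrib, neg_neg,
    Finset.sum_comm]
  simp only [traceAt] at h2
  simp only [← Finset.sum_smul, h2]
  simp only [← map_smul, ← map_sum, smul_smul]
  simp only [ContinuousLinearMap.map_smul]
  rw [hP.diagonalOperator_sum_smul, tangentProj_sphere_apply hpN,
    hP.inner_diagonalOperator_self _ hp]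
  -- This radial component is removed by the projection to the sphere; writing p = ∑ Pᵢ p yields the
  -- term subtracted in `laplacianCoeff`.
  have h3 : ∑ i, κ i * (n i * (r i ^ 2)⁻¹) * r i ^ 2 = ∑ i, κ i * n i :=
    Finset.sum_congr rfl fun i _ => by
      have := (hr i).ne'
      field_simp
  rw [h3]
  simp only [diagonalOperator_apply, laplacianCoeff, sub_smul, Finset.sum_sub_distrib,
    div_eq_mul_inv, ← Finset.smul_sum, hP.sum_apply]

theorem divTangentMap_id (hr : ∀ i, 0 < r i) (hsum : ∑ i, r i ^ 2 = 1)
    (hn : ∀ i, LinearMap.trace ℝ E (P i) = n i + 1) :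
    Set.EqOn (divTangentMap (sphereProduct P r) (Metric.sphere 0 1) id)
      (diagonalOperator P (laplacianCoeff n r fun _ => 1)) (sphereProduct P r) := fun p hp => by
  rw [divTangentMap, ← hP.neg_traceAt_fderivWithin_comp_extend hr hsum hn (fun _ => 1)
    (f := fun v => tangentMap (sphereProduct P r) id (extend (sphereProduct P r) v)) _ hp]
  · congr 1
    refine traceAt_congr fun e he => ?_
    rw [sub_eq_self, tangentMap, hP.leviCivita_extend_of_mem hr hp (extend_mem _ _ _) he, map_zero]
  · intro v q hq
    simp only [tangentMap_id hq (extend_mem _ _ _), diagonalOperator_apply, one_smul,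
      hP.sum_apply]

theorem laplacian_diagonalOperator (hr : ∀ i, 0 < r i) (hsum : ∑ i, r i ^ 2 = 1)
    (hn : ∀ i, LinearMap.trace ℝ E (P i) = n i + 1) {κ : ι → ℝ} {V : E → E}
    (hV : Set.EqOn V (diagonalOperator P κ) (sphereProduct P r)) {p : E}
    (hp : p ∈ sphereProduct P r) :
    laplacian (sphereProduct P r) (Metric.sphere 0 1) id V p =
      diagonalOperator P (laplacianCoeff n r κ) p := by
  rw [laplacian, ← hP.neg_traceAt_fderivWithin_comp_extend hr hsum hn κ
    (f := fun v => pullbackConn (sphereProduct P r) (Metric.sphere 0 1) id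
      (extend (sphereProduct P r) v) V)
    (fun v q hq => hP.pullbackConn_diagonalOperator hr hsum hV hq (extend_mem _ _ _)) hp]
  congr 1
  refine traceAt_congr fun e he => ?_
  rw [sub_eq_self, pullbackConn, hP.leviCivita_extend_of_mem hr hp (extend_mem _ _ _) he, map_zero,
    map_zero]

/-- V is normal to the product, so only the term ⟪e, e⟫ V of the sphere's curvature survives, and
the trace counts the dimension. -/
theorem curvatureEnd_diagonalOperator (hr : ∀ i, 0 < r i) (hsum : ∑ i, r i ^ 2 = 1)
    (hn : ∀ i, LinearMap.trace ℝ E (P i) = n i + 1) {κ : ι → ℝ} (hκ : ∑ i, κ i * r i ^ 2 = 0)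
    {V : E → E} (hV : Set.EqOn V (diagonalOperator P κ) (sphereProduct P r)) {p : E}
    (hp : p ∈ sphereProduct P r) :
    curvatureEnd (sphereProduct P r) (Metric.sphere 0 1) id V p =
      (∑ i, n i) • diagonalOperator P κ p := by
  have h1 : ∀ e ∈ tangentSpace (sphereProduct P r) p,
      curvature (Metric.sphere 0 1) (id p) (V p)
        (tangentMap (sphereProduct P r) id (extend (sphereProduct P r) e) p)
        (tangentMap (sphereProduct P r) id (extend (sphereProduct P r) e) p) =
      ⟪e, diagonalOperator P (fun _ => 1) e⟫ • diagonalOperator P κ p := fun e he => by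
    have he0 := hP.inner_self_of_mem hp he
    rw [tangentMap_id hp (extend_mem _ _ _), extend_of_mem he, hV hp, id,
      curvature_sphere_apply (hP.sphereProduct_subset_sphere hsum hp)
        (by rw [hP.inner_diagonalOperator_self κ hp, hκ]) he0 he0,
      hP.inner_diagonalOperator_of_mem κ hp he, zero_smul, sub_zero]
    simp only [diagonalOperator_apply, one_smul, hP.sum_apply]
  have h2 := hP.traceAt_inner_diagonalOperator hr hn (fun _ => 1) hp
  simp only [one_mul] at h2
  rw [curvatureEnd, traceAt_congr (C := fun u v => ⟪u, diagonalOperator P (fun _ => 1) v⟫ •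
    diagonalOperator P κ p) h1, ← h2, traceAt, traceAt, Finset.sum_smul]

/-- Here ∇ₑV is the diagonal operator applied to e, again orthogonal to V, so the trace of that
operator on the tangent space appears. -/
theorem curvatureDerivTerm_diagonalOperator (hr : ∀ i, 0 < r i) (hsum : ∑ i, r i ^ 2 = 1)
    (hn : ∀ i, LinearMap.trace ℝ E (P i) = n i + 1) {κ : ι → ℝ} (hκ : ∑ i, κ i * r i ^ 2 = 0)
    {V : E → E} (hV : Set.EqOn V (diagonalOperator P κ) (sphereProduct P r)) {p : E}
    (hp : p ∈ sphereProduct P r) :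
    curvatureDerivTerm (sphereProduct P r) (Metric.sphere 0 1) id V p =
      (∑ i, κ i * n i) • diagonalOperator P κ p := by
  have h1 : ∀ e ∈ tangentSpace (sphereProduct P r) p,
      curvature (Metric.sphere 0 1) (id p) (V p)
        (tangentMap (sphereProduct P r) id (extend (sphereProduct P r) e) p)
        (pullbackConn (sphereProduct P r) (Metric.sphere 0 1) id
          (extend (sphereProduct P r) e) V p) =
      ⟪e, diagonalOperator P κ e⟫ • diagonalOperator P κ p := fun e he => by
    have hKe := hP.diagonalOperator_mem hr κ hp he
    rw [tangentMap_id hp (extend_mem _ _ _),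
      hP.pullbackConn_diagonalOperator hr hsum hV hp (extend_mem _ _ _), extend_of_mem he, hV hp,
      id, curvature_sphere_apply (hP.sphereProduct_subset_sphere hsum hp)
        (by rw [hP.inner_diagonalOperator_self κ hp, hκ]) (hP.inner_self_of_mem hp he)
        (hP.inner_self_of_mem hp hKe),
      hP.inner_diagonalOperator_of_mem κ hp hKe, zero_smul, sub_zero, real_inner_comm]
  rw [curvatureDerivTerm, traceAt_congr (C := fun u v => ⟪u, diagonalOperator P κ v⟫ •
    diagonalOperator P κ p) h1, ← hP.traceAt_inner_diagonalOperator hr hn κ hp, traceAt, traceAt,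
    Finset.sum_smul]

end IsOrthogonalResolution

end Inclusion

/-! ### The C-harmonic operator on diagonal sections. -/

section CHarmonic

variable {E ι : Type*} [NormedAddCommGroup E] [InnerProductSpace ℝ E] [Fintype ι] [DecidableEq ι]
  [FiniteDimensional ℝ E] {P : ι → E →L[ℝ] E} {r n : ι → ℝ}

/-- The coefficients of `(δd - S + c) V` for the section `V : q ↦ ∑ κᵢ Pᵢ q`. -/
noncomputable def shiftedLaplacianCoeff (n r : ι → ℝ) (c : ℝ) (κ : ι → ℝ) (i : ι) : ℝ :=
  laplacianCoeff n r κ i - (∑ j, n j) * κ i + c * κ i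

omit [DecidableEq ι] in
theorem sum_shiftedLaplacianCoeff_mul_sq (hr : ∀ i, 0 < r i) (hsum : ∑ i, r i ^ 2 = 1) (c : ℝ)
    {κ : ι → ℝ} (hκ : ∑ i, κ i * r i ^ 2 = 0) :
    ∑ i, shiftedLaplacianCoeff n r c κ i * r i ^ 2 = 0 := by
  simp only [shiftedLaplacianCoeff, add_mul, sub_mul, Finset.sum_add_distrib,
    Finset.sum_sub_distrib, mul_assoc, ← Finset.mul_sum, hκ, sum_laplacianCoeff_mul_sq hr hsum]
  ring

namespace IsOrthogonalResolution

variable (hP : IsOrthogonalResolution P)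
include hP

theorem shiftedLaplacian_diagonalOperator (hr : ∀ i, 0 < r i) (hsum : ∑ i, r i ^ 2 = 1)
    (hn : ∀ i, LinearMap.trace ℝ E (P i) = n i + 1) {κ : ι → ℝ} (hκ : ∑ i, κ i * r i ^ 2 = 0)
    {V : E → E} (hV : Set.EqOn V (diagonalOperator P κ) (sphereProduct P r)) (c : ℝ) {p : E}
    (hp : p ∈ sphereProduct P r) :
    laplacian (sphereProduct P r) (Metric.sphere 0 1) id V p
        - curvatureEnd (sphereProduct P r) (Metric.sphere 0 1) id V p + c • V p =
      diagonalOperator P (shiftedLaplacianCoeff n r c κ) p := by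
  rw [hP.laplacian_diagonalOperator hr hsum hn hV hp,
    hP.curvatureEnd_diagonalOperator hr hsum hn hκ hV hp, hV hp]
  simp only [diagonalOperator_apply, shiftedLaplacianCoeff, add_smul, sub_smul, mul_smul,
    Finset.sum_add_distrib, Finset.sum_sub_distrib, ← Finset.smul_sum]

theorem cHarmonicOperatorSix_id (hr : ∀ i, 0 < r i) (hsum : ∑ i, r i ^ 2 = 1)
    (hn : ∀ i, LinearMap.trace ℝ E (P i) = n i + 1) {p : E} (hp : p ∈ sphereProduct P r)
    {s : ℝ} (hs : s = ∑ i, n i * (n i - 1) / r i ^ 2) {τ : ι → ℝ}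
    (hτ : τ = laplacianCoeff n r fun _ => 1) :
    cHarmonicOperatorSix (sphereProduct P r) (Metric.sphere 0 1) id p =
      diagonalOperator P (fun i =>
        shiftedLaplacianCoeff n r (2 * s / 15) (shiftedLaplacianCoeff n r (s / 5) τ) i
          - 2 * ((∑ j, τ j * n j) * τ i)) p := by
  have hscal : ∀ q ∈ sphereProduct P r, scal (sphereProduct P r) q = s := fun q hq => by
    rw [hP.scal_eq hr hq, hs]
    refine Finset.sum_congr rfl fun i _ => ?_
    rw [hn]
    ring
  have hτV := hP.divTangentMap_id hr hsum hn
  rw [← hτ] at hτV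
  have hτ0 : ∑ i, τ i * r i ^ 2 = 0 := hτ ▸ sum_laplacianCoeff_mul_sq hr hsum _
  -- The inner factor yields a diagonal section with constant coefficients, so the same computation
  -- applies to the outer factor.
  have hW : Set.EqOn (fun q =>
      laplacian (sphereProduct P r) (Metric.sphere 0 1) id
          (divTangentMap (sphereProduct P r) (Metric.sphere 0 1) id) q
        - curvatureEnd (sphereProduct P r) (Metric.sphere 0 1) id
          (divTangentMap (sphereProduct P r) (Metric.sphere 0 1) id) q
        + (scal (sphereProduct P r) q / 5) •
          divTangentMap (sphereProduct P r) (Metric.sphere 0 1) id q)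
      (diagonalOperator P (shiftedLaplacianCoeff n r (s / 5) τ)) (sphereProduct P r) :=
    fun q hq => by
      simp only [hscal q hq]
      exact hP.shiftedLaplacian_diagonalOperator hr hsum hn hτ0 hτV _ hq
  have hpW := hP.shiftedLaplacian_diagonalOperator hr hsum hn
    (sum_shiftedLaplacianCoeff_mul_sq (n := n) hr hsum (s / 5) hτ0) hW (2 * s / 15) hp
  simp only [hscal p hp] at hpW
  simp only [cHarmonicOperatorSix]
  rw [hP.curvatureDerivTerm_diagonalOperator hr hsum hn hτ0 hτV hp, hscal p hp, hpW]
  simp only [diagonalOperator_apply, sub_smul, mul_smul, Finset.sum_sub_distrib,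
    ← Finset.smul_sum]

end IsOrthogonalResolution

end CHarmonic

/-! ### Clifford tori and the positivity of the quartic. -/

section CliffordTorus

variable (n₁ n₂ : ℕ)

/-- The projections of `ℝ^(n₁+1) × ℝ^(n₂+1)` onto its two factors. -/
noncomputable def factorProj (i : Fin 2) : ProdSpace n₁ n₂ →L[ℝ] ProdSpace n₁ n₂ :=
  (WithLp.prodContinuousLinearEquiv 2 ℝ _ _).symm.toContinuousLinearMap ∘L
    (if i = 0 then (ContinuousLinearMap.inl ℝ _ _).comp (WithLp.fstL 2 ℝ _ _)
      else (ContinuousLinearMap.inr ℝ _ _).comp (WithLp.sndL 2 ℝ _ _))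

theorem factorProj_zero_apply (x : ProdSpace n₁ n₂) :
    factorProj n₁ n₂ 0 x = WithLp.toLp 2 (x.fst, 0) := rfl

theorem factorProj_one_apply (x : ProdSpace n₁ n₂) :
    factorProj n₁ n₂ 1 x = WithLp.toLp 2 (0, x.snd) := rfl

theorem isOrthogonalResolution_factorProj : IsOrthogonalResolution (factorProj n₁ n₂) where
  inner_comm i x y := by
    fin_cases i <;>
      simp [factorProj_zero_apply, factorProj_one_apply, WithLp.prod_inner_apply]
  apply_self i x := by
    fin_cases i <;> simp [factorProj_zero_apply, factorProj_one_apply]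
  apply_of_ne i j x h := by
    fin_cases i <;> fin_cases j <;> first
      | exact (h rfl).elim
      | simp [factorProj_zero_apply, factorProj_one_apply]
  sum_apply x := by
    rw [Fin.sum_univ_two, factorProj_zero_apply, factorProj_one_apply, ← WithLp.toLp_add,
      Prod.mk_add_mk, add_zero, zero_add]
    rfl

theorem cliffordTorus_eq_sphereProduct (a b : ℝ) :
    cliffordTorus n₁ n₂ a b = sphereProduct (factorProj n₁ n₂) ![a, b] := by
  ext q
  simp [cliffordTorus, sphereProduct, Fin.forall_fin_two, factorProj_zero_apply,
    factorProj_one_apply]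

theorem trace_factorProj (i : Fin 2) :
    LinearMap.trace ℝ (ProdSpace n₁ n₂) (factorProj n₁ n₂ i) = ![(n₁ : ℝ), n₂] i + 1 := by
  rw [LinearMap.trace_eq_sum_inner _ ((EuclideanSpace.basisFun (Fin (n₁ + 1)) ℝ).prod
    (EuclideanSpace.basisFun (Fin (n₂ + 1)) ℝ)), Fintype.sum_sum_type]
  fin_cases i <;>
    simp [factorProj_zero_apply, factorProj_one_apply, WithLp.prod_inner_apply]

theorem cliffordTorus_nonempty {a b : ℝ} (ha : 0 < a) (hb : 0 < b) :
    (cliffordTorus n₁ n₂ a b).Nonempty :=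
  ⟨WithLp.toLp 2 (EuclideanSpace.single 0 a, EuclideanSpace.single 0 b), by
    simp [cliffordTorus, abs_of_pos ha, abs_of_pos hb]⟩

/-- The positivity which excludes non-minimal C-harmonic Clifford tori of dimension six, in terms
of `t = (b / a) ^ 2`. -/
theorem clifford_polynomial_pos {n₁ n₂ : ℕ} (hn₁ : 1 ≤ n₁) (hn₂ : 1 ≤ n₂) (hdim : n₁ + n₂ = 6)
    {t : ℝ} (ht : 0 < t) {s : ℝ}
    (hs : s = n₁ * (n₁ - 1) * (t + 1) * t + n₂ * (n₂ - 1) * (t + 1)) :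
    0 < (n₁ * t ^ 2 + n₂ - 6 * t + 2 * s / 15) * (n₁ * t ^ 2 + n₂ - 6 * t + s / 5)
      - 2 * t * (n₁ * t - n₂) ^ 2 := by
  -- Here `s` stands for t times the scalar curvature, so each splitting gives a quartic in t.
  have h : n₁ = 1 ∧ n₂ = 5 ∨ n₁ = 2 ∧ n₂ = 4 ∨ n₁ = 3 ∧ n₂ = 3 ∨ n₁ = 4 ∧ n₂ = 2 ∨
    n₁ = 5 ∧ n₂ = 1 := by omega
  subst hs
  rcases h with ⟨rfl, rfl⟩ | ⟨rfl, rfl⟩ | ⟨rfl, rfl⟩ | ⟨rfl, rfl⟩ | ⟨rfl, rfl⟩ <;> push_cast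
  -- The cubic coefficient is −22/3. Subtracting the first square leaves (215/9)t² − (220/3)t + 60,
  -- which has negative discriminant and its minimum near 3/2.
  · nlinarith [sq_nonneg (t ^ 2 - 11 / 3 * t + 3), sq_nonneg (t - 3 / 2), sq_nonneg t]
  · nlinarith [sq_nonneg (t ^ 2 - t), sq_nonneg (t - 1), sq_nonneg t]
  · nlinarith [sq_nonneg (t ^ 2 - t), sq_nonneg (t - 1), sq_nonneg t]
  · nlinarith [sq_nonneg (t ^ 2 - t), sq_nonneg (t - 1), sq_nonneg t]
  -- This is the quartic of the splitting (1, 5) with reversed coefficients, by t ↦ 1/t; the first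
  -- two squares are reversed likewise.
  · nlinarith [sq_nonneg (3 * t ^ 2 - 11 / 3 * t + 1), sq_nonneg (t * (3 / 2 * t - 1)),
      sq_nonneg (t - 1), sq_nonneg t, sq_nonneg (t ^ 2)]

/-- Tangency determines `x 1` from `x 0`, so the operator acts as a scalar; multiplying by t = b²/a²
clears the denominator of |A|² = n₁t + n₂/t. -/
theorem shiftedLaplacianCoeff_zero_mul {n₁ n₂ a b : ℝ} (ha : 0 < a)
    (hab : a ^ 2 + b ^ 2 = 1) (c : ℝ) {x : Fin 2 → ℝ}
    (hx : ∑ i, x i * ![a, b] i ^ 2 = 0) :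
    shiftedLaplacianCoeff ![n₁, n₂] ![a, b] c x 0 * (b ^ 2 / a ^ 2) =
      x 0 * (n₁ * (b ^ 2 / a ^ 2) ^ 2 + n₂ - (n₁ + n₂) * (b ^ 2 / a ^ 2) + c * (b ^ 2 / a ^ 2)) := by
  simp only [Fin.sum_univ_two, Matrix.cons_val_zero, Matrix.cons_val_one] at hx
  have hx1 : x 1 * b ^ 2 = -(x 0 * a ^ 2) := by linarith
  have h1 : n₁ / a ^ 2 = n₁ * (b ^ 2 / a ^ 2) + n₁ := by
    field_simp
    linear_combination -n₁ * hab
  have h2 : x 1 * n₂ * (b ^ 2 / a ^ 2) = -(x 0 * n₂) := by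
    field_simp
    linear_combination n₂ * hx1
  simp only [shiftedLaplacianCoeff, laplacianCoeff, Fin.sum_univ_two, Matrix.cons_val_zero,
    Matrix.cons_val_one, h1]
  linear_combination -h2

end CliffordTorus

end EuclideanSubmanifold

open EuclideanSubmanifold in
theorem mainTheorem10 (n₁ n₂ : ℕ) (hn₁ : 1 ≤ n₁) (hn₂ : 1 ≤ n₂) (hdim : n₁ + n₂ = 6)
    (a b : ℝ) (ha : 0 < a) (hb : 0 < b) (hab : a ^ 2 + b ^ 2 = 1) :
    ¬ EuclideanSubmanifold.IsProperlyCHarmonicSix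
        (EuclideanSubmanifold.cliffordTorus n₁ n₂ a b)
        (EuclideanSubmanifold.unitSphere n₁ n₂) := by
  rintro ⟨⟨-, -, hC⟩, hH⟩
  have hP := isOrthogonalResolution_factorProj n₁ n₂
  have hr : ∀ i, 0 < ![a, b] i := Fin.forall_fin_two.2 ⟨ha, hb⟩
  have hsum : ∑ i, ![a, b] i ^ 2 = 1 := by simpa [Fin.sum_univ_two] using hab
  have hn := trace_factorProj n₁ n₂
  have hdim' : (n₁ : ℝ) + n₂ = 6 := by exact_mod_cast hdim
  obtain ⟨p, hp⟩ := cliffordTorus_nonempty n₁ n₂ ha hb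
  rw [unitSphere, cliffordTorus_eq_sphereProduct] at hC hH
  rw [cliffordTorus_eq_sphereProduct] at hp
  obtain ⟨τ, hτ⟩ : ∃ τ, τ = laplacianCoeff ![(n₁ : ℝ), n₂] ![a, b] fun _ => 1 := ⟨_, rfl⟩
  obtain ⟨s, hs⟩ : ∃ s, s = ∑ i, ![(n₁ : ℝ), n₂] i * (![(n₁ : ℝ), n₂] i - 1) / ![a, b] i ^ 2 :=
    ⟨_, rfl⟩
  have hτ0 : ∑ i, τ i * ![a, b] i ^ 2 = 0 := hτ ▸ sum_laplacianCoeff_mul_sq hr hsum _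
  have hω := hC p hp
  rw [hP.cHarmonicOperatorSix_id hr hsum hn hp hs hτ] at hω
  -- One coefficient suffices, since tangency makes the other proportional to it.
  have hω0 := hP.eq_zero_of_diagonalOperator_apply_eq_zero hr hp hω 0
  have h1 := shiftedLaplacianCoeff_zero_mul (n₁ := n₁) (n₂ := n₂) ha hab (2 * s / 15)
    (sum_shiftedLaplacianCoeff_mul_sq (n := ![(n₁ : ℝ), n₂]) hr hsum (s / 5) hτ0)
  have h2 := shiftedLaplacianCoeff_zero_mul (n₁ := n₁) (n₂ := n₂) ha hab (s / 5) hτ0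
  rw [hdim'] at h1 h2
  obtain ⟨t, ht⟩ : ∃ t, t = b ^ 2 / a ^ 2 := ⟨_, rfl⟩
  have ht0 : 0 < t := ht ▸ by positivity
  have hτa : τ 0 = n₁ * t - n₂ := by
    rw [hτ, ht]
    simp only [laplacianCoeff, Fin.sum_univ_two, Matrix.cons_val_zero, Matrix.cons_val_one]
    field_simp
    linear_combination -(n₁ : ℝ) * hab
  simp only [Fin.sum_univ_two, Matrix.cons_val_zero, Matrix.cons_val_one] at hτ0 hω0 hs
  have hst : s * t = n₁ * (n₁ - 1) * (t + 1) * t + n₂ * (n₂ - 1) * (t + 1) := by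
    have h3 : t + 1 = 1 / a ^ 2 := by
      rw [ht]
      field_simp
      linear_combination hab
    rw [hs, h3, ht]
    field_simp
  have hτb : τ 1 * t = -τ 0 := by
    rw [ht]
    field_simp
    linear_combination hτ0
  rw [← ht] at h1 h2
  have hpos := clifford_polynomial_pos hn₁ hn₂ hdim ht0 hst
  -- This is t² times the vanishing coefficient: one t for each second-order factor. In the
  -- curvature term, (n₁τ₀ + n₂τ₁)t = τ₀(n₁t − n₂).
  have hzero : τ 0 * ((n₁ * t ^ 2 + n₂ - 6 * t + 2 * (s * t) / 15) *
      (n₁ * t ^ 2 + n₂ - 6 * t + s * t / 5) - 2 * t * (n₁ * t - n₂) ^ 2) = 0 := by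
    linear_combination t ^ 2 * hω0 - t * h1 - (n₁ * t ^ 2 + n₂ - 6 * t + 2 * s / 15 * t) * h2
      + 2 * t * n₂ * τ 0 * hτb + 2 * t * τ 0 * (n₁ * t - n₂) * hτa
  have hτ00 : τ 0 = 0 := (mul_eq_zero.1 hzero).resolve_right hpos.ne'
  have hτ10 : τ 1 = 0 := by
    rw [hτ00, neg_zero] at hτb
    exact (mul_eq_zero.1 hτb).resolve_right ht0.ne'
  refine hH fun q hq => ?_
  rw [hP.divTangentMap_id hr hsum hn hq, ← hτ, diagonalOperator_apply, Fin.sum_univ_two, hτ00,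
    hτ10, zero_smul, zero_smul, add_zero]
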